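/- Let $n\ge 1$ be an integer, $d>0$ and $\gamma,c,\alpha>0$ real numbers, and let $G$ be a graph with $n$ vertices. Give each vertex $u$ of $G$, of degree $\Delta(u)$, the weight $W(u)=(1+\gamma)^{-1}$ if $\Delta(u)\le(1+\alpha)d$, and $W(u)=d^{c}\Delta(u)$ otherwise. Paths are self-avoiding and the length of a path or cycle is its number of edges. The influence on a vertex $v$ is $$E(v)=\max_{L}\ \prod_{u\in L}W(u),$$ where $L$ runs over all paths of $G$ of length at most $\ln n/d^{2/5}$ that start at $v$ (including the path that consists of $v$ alone). A vertex $v$ is a break-point if $E(v)\le 1$. A path $L$ of $G$ is elementary if no cycle of $G$ shorter than $10\ln n/d^{2/5}$ contains two distinct vertices of $L$. **Theorem.** Let $\gamma,c>0$ and $\alpha\in(0,3/2)$ be fixed. There is $d_0=d_0(\gamma,c,\alpha)$ such that for every real $d\ge d_0$ there is $n_0=n_0(d,\gamma,c,\alpha)$ such that for every $n\ge n_0$ the following holds. Let $G(n,d/n)$ be the random graph on $n$ vertices in which each pair of vertices is joined by an edge independently with probability $d/n$, and let $\mathbb U$ be the set of all elementary paths of $G(n,d/n)$ of length $\lfloor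 \ln n/(\ln d)^5\rfloor$ that contain no break-point. Then $$\Pr[\mathbb U\neq\emptyset]\ \le\ n^{-\frac13\,\frac{\gamma}{1+\gamma}\,\ln d}.$$ -/

import Mathlib

noncomputable section

namespace RandomGraphPaths

open Classical in
/-- The weight `W(u)` of a vertex `u` of `G`: it is `(1 + γ)⁻¹` if the degree `Δ(u)` is at most
`(1 + α) d`, and `d ^ c * Δ(u)` otherwise. -/
def weight {V : Type*} [Fintype V] (G : SimpleGraph V) (d α γ c : ℝ) (u : V) : ℝ :=
  if (G.degree u : ℝ) ≤ (1 + α) * d then (1 + γ)⁻¹ else d ^ c * (G.degree u : ℝ)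

/-- The weight of a walk: the product of the weights of its vertices. -/
def walkWeight {V : Type*} [Fintype V] (G : SimpleGraph V) (d α γ c : ℝ) {v w : V}
    (p : G.Walk v w) : ℝ :=
  (p.support.map (weight G d α γ c)).prod

/-- The maximal number of edges `ln n / d ^ (2/5)` of the paths that count for the influence on
a vertex, where `n` is the number of vertices. -/
def radius (V : Type*) [Fintype V] (d : ℝ) : ℝ :=
  Real.log (Fintype.card V : ℝ) / d ^ (2 / 5 : ℝ)

/-- The set of the weights of all the (self-avoiding) paths that start at `v` and have
at most `ln n / d ^ (2/5)` edges. -/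
def pathWeights {V : Type*} [Fintype V] (G : SimpleGraph V) (d α γ c : ℝ) (v : V) : Set ℝ :=
  {x | ∃ (w : V) (p : G.Walk v w),
    p.IsPath ∧ (p.length : ℝ) ≤ radius V d ∧ x = walkWeight G d α γ c p}

/-- The influence `E(v)` on a vertex `v`: the maximum of the weights of the paths that start
at `v` and have at most `ln n / d ^ (2/5)` edges. -/
def influence {V : Type*} [Fintype V] (G : SimpleGraph V) (d α γ c : ℝ) (v : V) : ℝ :=
  sSup (pathWeights G d α γ c v)

/-- The supremum in the definition of the influence is a maximum. -/
theorem isGreatest_influence {V : Type*} [Fintype V] (G : SimpleGraph V) (d α γ c : ℝ)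
    (hd : 0 ≤ d) (v : V) :
    IsGreatest (pathWeights G d α γ c v) (influence G d α γ c v) := by
  classical
  have hne : (pathWeights G d α γ c v).Nonempty := by
    refine ⟨_, v, SimpleGraph.Walk.nil, SimpleGraph.Walk.IsPath.nil, ?_, rfl⟩
    have h1 : (1 : ℝ) ≤ (Fintype.card V : ℝ) := by
      exact_mod_cast Fintype.card_pos_iff.mpr ⟨v⟩
    have h2 := Real.log_nonneg h1
    simp only [SimpleGraph.Walk.length_nil, Nat.cast_zero, radius]
    positivity
  have hfin : (pathWeights G d α γ c v).Finite := by
    refine (Set.finite_range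
      (fun q : Σ w : V, G.Path v w => walkWeight G d α γ c q.2.1)).subset ?_
    rintro x ⟨w, p, hp, -, rfl⟩
    exact ⟨⟨w, p, hp⟩, rfl⟩
  exact hne.csSup_mem hfin |> fun h => ⟨h, fun y hy => le_csSup hfin.bddAbove hy⟩

/-- A break-point is a vertex on which the influence is at most `1`. -/
def IsBreakPoint {V : Type*} [Fintype V] (G : SimpleGraph V) (d α γ c : ℝ) (v : V) : Prop :=
  influence G d α γ c v ≤ 1

/-- A path `p` is elementary if no cycle with fewer than `10 ln n / d ^ (2/5)` edges contains
two (distinct) vertices of `p`. -/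
def IsElementary {V : Type*} [Fintype V] (G : SimpleGraph V) (d : ℝ) {v w : V}
    (p : G.Walk v w) : Prop :=
  p.IsPath ∧ ¬ ∃ (u : V) (C : G.Walk u u), C.IsCycle ∧ (C.length : ℝ) < 10 * radius V d ∧
    ∃ x y : V, x ≠ y ∧ x ∈ p.support ∧ y ∈ p.support ∧ x ∈ C.support ∧ y ∈ C.support

/-- `G` has an elementary path with `⌊ln n / (ln d) ^ 5⌋` edges that contains no break-point,
i.e. the set of all such paths is non-empty. -/
def HasUnbrokenPath {V : Type*} [Fintype V] (G : SimpleGraph V) (d α γ c : ℝ) : Prop :=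
  ∃ (v w : V) (p : G.Walk v w), IsElementary G d p ∧
    p.length = ⌊Real.log (Fintype.card V : ℝ) / Real.log d ^ 5⌋₊ ∧
    ∀ x ∈ p.support, ¬ IsBreakPoint G d α γ c x

end RandomGraphPaths

end

/-! Absence of break-points forces a large connected set with far too much degree, and a first
moment bound over trees rules this out.

Each vertex of an unbroken path starts a path of weight above `1` and length at most `radius`.
Taking logarithms, its vertices of degree above `(1 + α) d` have total degree at least `d / β` per
vertex of the path, with `β` of order `ln d`. Elementarity makes an initial segment of the unbroken
path geodesic at this scale, so a Vitali selection finds disjoint witness paths whose total size is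
proportional to that of the segment. Together with it they form a connected set `H` with more than
`radius` vertices and heavy degree sum at least `|H| d / (7 β)` (`exists_connected_of_geodesic`,
`exists_heavy_tree`).

`H` is spanned by a tree with `e = |H| - 1` edges. At most `n (4n)^e` rooted trees and `2^(e+1)`
heavy subsets must be considered, while Chernoff's bound, taken jointly with the presence of the
tree, gives `(p exp (α/2))^e exp (-κ (e+1) d / (7 β))`, where `κ = α² / (8 (1 + α))`. As `p n = d`,
the entropy is only `O(ln d)` per vertex, against a gain of order `d / ln d`. This beats `d^(2/5) ln
d`, so sizes above `ln n / d^(2/5)` yield the required power of `n`. -/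

namespace RandomGraphPaths

/-! ### Geodesic paths and the covering argument -/

open SimpleGraph

variable {V : Type*}

/-- A path whose vertices lie on a path `p` is the only path with its end-points, unless there is
a cycle that contains two vertices of `p` and is at most as long as the two paths together. -/
theorem eq_of_no_short_cycle {G : SimpleGraph V} {a b x y : V} (p : G.Walk a b) {N : ℕ}
    (hp : ∀ (u : V) (C : G.Walk u u), C.IsCycle → C.length ≤ N →
      ∀ s t : V, s ∈ p.support → t ∈ p.support → s ∈ C.support → t ∈ C.support → s = t)
    (q q' : G.Walk x y) (hq : q.IsPath) (hq' : q'.IsPath) (hsub : q'.support ⊆ p.support)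
    (hN : q.length + q'.length ≤ N) : q = q' := by
  by_contra hne
  obtain ⟨u, v, s, t, hs, ht, hC⟩ := hq.exists_isCycle_of_ne hq' hne
  have hlen : (s.append t.reverse).length ≤ N := by
    have h1 := Walk.length_le_of_isSubwalk hs
    have h2 := Walk.length_le_of_isSubwalk ht
    simp only [Walk.length_append, Walk.length_reverse]
    omega
  -- The two ends `u`, `v` of the arcs forming the cycle lie on `q'`, hence on `p`. They must
  -- coincide, so both arcs are trivial and there is no cycle.
  have huv : u = v := hp _ _ hC hlen u v
    (hsub (ht.support_subset t.start_mem_support)) (hsub (ht.support_subset t.end_mem_support))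
    (by simp) (by simp)
  subst huv
  have h1 : s.IsPath := Walk.isPath_of_isSubwalk hs hq
  have h2 : t.IsPath := Walk.isPath_of_isSubwalk ht hq'
  rw [Walk.isPath_iff_nil] at h1 h2
  obtain rfl := h1.eq_nil
  obtain rfl := h2.eq_nil
  simp at hC

/-- The segment of a path between two of its vertices. -/
theorem exists_segment {G : SimpleGraph V} {a b : V} (p : G.Walk a b) (hp : p.IsPath) {i j : ℕ}
    (hij : i ≤ j) (hj : j ≤ p.length) :
    ∃ q : G.Walk (p.getVert i) (p.getVert j), q.IsPath ∧ q.length = j - i ∧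
      q.support ⊆ p.support := by
  have h : (p.take j).getVert i = p.getVert i := by
    rw [Walk.take_getVert, min_eq_right hij]
  refine ⟨((p.take j).drop i).copy h rfl, ?_, ?_, ?_⟩
  · rw [Walk.isPath_copy]
    exact (hp.take j).drop i
  · rw [Walk.length_copy, Walk.drop_length, Walk.take_length, min_eq_left hj]
  · rw [Walk.support_copy]
    exact (((p.take j).isSubwalk_drop i).trans (p.isSubwalk_take j)).support_subset

/-- A path without short cycles through two of its vertices is geodesic at small scales. -/
theorem dist_le_of_no_short_cycle {G : SimpleGraph V} {a b : V} (p : G.Walk a b) (hp : p.IsPath)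
    {N M : ℕ} (hc : ∀ (u : V) (C : G.Walk u u), C.IsCycle → C.length ≤ N →
      ∀ s t : V, s ∈ p.support → t ∈ p.support → s ∈ C.support → t ∈ C.support → s = t)
    (hN : M + p.length ≤ N) {i j : ℕ} (hij : i ≤ j) (hj : j ≤ p.length)
    (q : G.Walk (p.getVert i) (p.getVert j)) (hq : q.length ≤ M) : j ≤ i + q.length := by
  classical
  obtain ⟨s, hs, hsl, hsub⟩ := exists_segment p hp hij hj
  have h1 := q.length_bypass_le_length
  have h2 := eq_of_no_short_cycle p hc q.bypass s q.bypass_isPath hs hsub (by omega)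
  rw [h2] at h1
  omega

open Classical in
/-- If a locally geodesic path `p` has at each vertex a short path that starts there and on which
the mass of a function `g` is large, then `p` is contained in a connected set on which the mass
of `g` is large. -/
theorem exists_connected_of_geodesic {G : SimpleGraph V} {a b : V} (p : G.Walk a b)
    (hp : p.IsPath) {R : ℕ} {β : ℝ} (hβ : 0 ≤ β) (g : V → ℝ) (hg : ∀ v, 0 ≤ g v)
    (hgeo : ∀ i j : ℕ, i ≤ j → j ≤ p.length → ∀ q : G.Walk (p.getVert i) (p.getVert j),
      q.length ≤ 2 * R → j ≤ i + q.length)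
    (hmass : ∀ v ∈ p.support, ∃ (w : V) (q : G.Walk v w), q.IsPath ∧ q.length ≤ R ∧
      (q.length : ℝ) + 1 ≤ β * ∑ u ∈ q.support.toFinset, g u) :
    ∃ H : Finset V, a ∈ H ∧ p.length + 1 ≤ H.card ∧
      (∀ w ∈ H, ∃ q : G.Walk a w, ∀ x ∈ q.support, x ∈ H) ∧
      (H.card : ℝ) ≤ 7 * β * ∑ u ∈ H, g u := by
  have hmass' : ∀ i : ℕ, ∃ (w : V) (q : G.Walk (p.getVert i) w), q.IsPath ∧ q.length ≤ R ∧
      (q.length : ℝ) + 1 ≤ β * ∑ u ∈ q.support.toFinset, g u :=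
    fun i => hmass _ (p.getVert_mem_support i)
  choose w q hq hqR hqm using hmass'
  -- Every `q i` meets a selected `q j` with `|q i| ≤ 2 |q j|`. By geodesicity `|i - j| ≤ |q i| + |q
  -- j| ≤ 3 |q j|`, whence the intervals of at most `6 |q j| + 1` indices below.
  obtain ⟨U, hU, hdisj, hcov⟩ := Vitali.exists_disjoint_subfamily_covering_enlargement
    (fun i => {x | x ∈ (q i).support}) {i | i ≤ p.length} (fun i => ((q i).length : ℝ)) 2
    one_lt_two (fun i _ => by positivity) R (fun i _ => by exact_mod_cast hqR i)
    (fun i _ => ⟨_, (q i).start_mem_support⟩)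
  lift U to Finset ℕ using (Set.finite_Iic p.length).subset hU
  set P : Finset V := U.biUnion fun i => (q i).support.toFinset with hP
  have hPmass : ∑ i ∈ U, (((q i).length : ℝ) + 1) ≤ β * ∑ u ∈ P, g u := by
    rw [hP, Finset.sum_biUnion, Finset.mul_sum]
    · exact Finset.sum_le_sum fun i _ => hqm i
    · intro i hi j hj hne
      have := hdisj hi hj hne
      rw [Function.onFun, Set.disjoint_left] at this
      rw [Function.onFun, Finset.disjoint_left]
      intro x hx hx'
      exact this (by simpa using hx) (by simpa using hx')
  have hlen : p.length + 1 ≤ ∑ i ∈ U, (6 * (q i).length + 1) := by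
    have hsub : Finset.range (p.length + 1) ⊆
        U.biUnion fun i => Finset.Icc (i - 3 * (q i).length) (i + 3 * (q i).length) := by
      intro i hi
      have hi' : i ≤ p.length := by simpa [Nat.lt_succ_iff] using hi
      obtain ⟨j, hj, ⟨x, hxi, hxj⟩, hl⟩ := hcov i hi'
      have hl' : (q i).length ≤ 2 * (q j).length := by exact_mod_cast hl
      have hj' : j ≤ p.length := hU hj
      have h1 := (q i).length_takeUntil_le_length hxi
      have h2 := (q j).length_takeUntil_le_length hxj
      have h3 := hqR i
      have h4 := hqR j
      rw [Finset.mem_biUnion]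
      refine ⟨j, hj, ?_⟩
      rw [Finset.mem_Icc]
      rcases le_total i j with hij | hij
      · have := hgeo i j hij hj' (((q i).takeUntil x hxi).append ((q j).takeUntil x hxj).reverse)
          (by simp only [Walk.length_append, Walk.length_reverse]; omega)
        simp only [Walk.length_append, Walk.length_reverse] at this
        omega
      · have := hgeo j i hij hi' (((q j).takeUntil x hxj).append ((q i).takeUntil x hxi).reverse)
          (by simp only [Walk.length_append, Walk.length_reverse]; omega)
        simp only [Walk.length_append, Walk.length_reverse] at this
        omega
    have h := (Finset.card_le_card hsub).trans Finset.card_biUnion_le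
    rw [Finset.card_range] at h
    refine h.trans (Finset.sum_le_sum fun i _ => ?_)
    rw [Nat.card_Icc]
    omega
  have hcardp : p.support.toFinset.card = p.length + 1 := by
    rw [List.toFinset_card_of_nodup hp.support_nodup, Walk.length_support]
  refine ⟨p.support.toFinset ∪ P, by simp, ?_, ?_, ?_⟩
  · rw [← hcardp]
    exact Finset.card_le_card Finset.subset_union_left
  · intro y hy
    rw [Finset.mem_union] at hy
    rcases hy with hy | hy
    · have hy' : y ∈ p.support := by simpa using hy
      refine ⟨p.takeUntil y hy', fun x hx => Finset.mem_union_left _ ?_⟩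
      simpa using p.support_takeUntil_subset_support hy' hx
    · rw [hP, Finset.mem_biUnion] at hy
      obtain ⟨i, hi, hy⟩ := hy
      have hy' : y ∈ (q i).support := by simpa using hy
      refine ⟨(p.takeUntil _ (p.getVert_mem_support i)).append ((q i).takeUntil y hy'),
        fun x hx => ?_⟩
      rw [Walk.mem_support_append_iff] at hx
      rcases hx with hx | hx
      · refine Finset.mem_union_left _ ?_
        simpa using p.support_takeUntil_subset_support _ hx
      · refine Finset.mem_union_right _ (Finset.mem_biUnion.2 ⟨i, hi, ?_⟩)
        simpa using (q i).support_takeUntil_subset_support hy' hx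
  · have hcardP : (P.card : ℝ) ≤ ∑ i ∈ U, (((q i).length : ℝ) + 1) := by
      have h : P.card ≤ ∑ i ∈ U, ((q i).length + 1) :=
        Finset.card_biUnion_le.trans (Finset.sum_le_sum fun i _ =>
          (List.toFinset_card_le _).trans (by rw [Walk.length_support]))
      exact_mod_cast h
    have hlen' : (p.length : ℝ) + 1 ≤ 6 * ∑ i ∈ U, (((q i).length : ℝ) + 1) := by
      have h : p.length + 1 ≤ 6 * ∑ i ∈ U, ((q i).length + 1) := by
        rw [Finset.mul_sum]
        exact hlen.trans (Finset.sum_le_sum fun i _ => by omega)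
      exact_mod_cast h
    have hH : ((p.support.toFinset ∪ P).card : ℝ) ≤ ((p.length : ℝ) + 1) + P.card := by
      have h := Finset.card_union_le p.support.toFinset P
      rw [hcardp] at h
      exact_mod_cast h
    have hmono : ∑ u ∈ P, g u ≤ ∑ u ∈ p.support.toFinset ∪ P, g u :=
      Finset.sum_le_sum_of_subset_of_nonneg Finset.subset_union_right fun u _ _ => hg u
    -- The constant is `7 = 6 + 1`: the segment costs at most six times the selected paths, and
    -- these are counted once more themselves.
    nlinarith [mul_le_mul_of_nonneg_left hmono hβ]

end RandomGraphPaths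

/-! ### Spanning trees and their number -/

namespace RandomGraphPaths

open SimpleGraph

variable {V : Type*}

/-- `IsRootedTree e v H T`: the edges `T` form a tree with `e` edges on the vertex set `H`, which
contains the root `v`. -/
inductive IsRootedTree [DecidableEq V] : ℕ → V → Finset V → Finset (Sym2 V) → Prop
  | single (v : V) : IsRootedTree 0 v {v} ∅
  | join {i j : ℕ} {v u : V} {H K : Finset V} {T U : Finset (Sym2 V)} :
      IsRootedTree i v H T → IsRootedTree j u K U → Disjoint H K →
      IsRootedTree (i + j + 1) v (H ∪ K) (insert s(v, u) (T ∪ U))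

namespace IsRootedTree

variable [DecidableEq V] {e : ℕ} {v : V} {H : Finset V} {T : Finset (Sym2 V)}

theorem root_mem (h : IsRootedTree e v H T) : v ∈ H := by
  induction h with
  | single v => simp
  | join _ _ _ ih _ => exact Finset.mem_union_left _ ih

theorem card_verts (h : IsRootedTree e v H T) : H.card = e + 1 := by
  induction h with
  | single v => simp
  | join _ _ hd ih ih' => rw [Finset.card_union_of_disjoint hd, ih, ih']; omega

theorem mem_of_mem_edge (h : IsRootedTree e v H T) : ∀ z ∈ T, ∀ x ∈ z, x ∈ H := by
  induction h with
  | single v => simp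
  | @join i j v u H K T U h h' hd ih ih' =>
    intro z hz x hx
    rw [Finset.mem_insert, Finset.mem_union] at hz
    rw [Finset.mem_union]
    rcases hz with rfl | hz | hz
    · rcases Sym2.mem_iff.1 hx with rfl | rfl
      · exact Or.inl h.root_mem
      · exact Or.inr h'.root_mem
    · exact Or.inl (ih z hz x hx)
    · exact Or.inr (ih' z hz x hx)

theorem card_edges (h : IsRootedTree e v H T) : T.card = e := by
  induction h with
  | single v => simp
  | @join i j v u H K T U h h' hd ih ih' =>
    rw [Finset.disjoint_left] at hd
    rw [Finset.card_insert_of_notMem, Finset.card_union_of_disjoint, ih, ih']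
    · rw [Finset.disjoint_left]
      rintro ⟨x, y⟩ hz hz'
      exact hd (h.mem_of_mem_edge _ hz x (by simp)) (h'.mem_of_mem_edge _ hz' x (by simp))
    · rw [Finset.mem_union, not_or]
      exact ⟨fun hz => hd (h.mem_of_mem_edge _ hz u (by simp)) h'.root_mem,
        fun hz => hd h.root_mem (h'.mem_of_mem_edge _ hz v (by simp))⟩

/-- `join` attaches only at the root; a leaf elsewhere is added by descending into the half that
contains `x`. -/
theorem exists_insert (h : IsRootedTree e v H T) {x w : V} (hx : x ∈ H) (hw : w ∉ H) :
    ∃ T', IsRootedTree (e + 1) v (insert w H) T' ∧ T' ⊆ insert s(x, w) T := by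
  induction h with
  | single v =>
    obtain rfl : x = v := by simpa using hx
    have := join (single x) (single w) (by simpa [eq_comm] using hw)
    refine ⟨_, ?_, Finset.Subset.refl _⟩
    rw [Finset.insert_eq, Finset.union_comm]
    simpa using this
  | @join i j v u H K T U h h' hd ih ih' =>
    rw [Finset.mem_union, not_or] at hw
    rcases Finset.mem_union.1 hx with hx | hx
    · obtain ⟨T', hT', hsub⟩ := ih hx hw.1
      have := join hT' h' (Finset.disjoint_insert_left.2 ⟨hw.2, hd⟩)
      rw [Finset.insert_union, show i + 1 + j + 1 = i + j + 1 + 1 by omega] at this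
      exact ⟨_, this, by grind⟩
    · obtain ⟨T', hT', hsub⟩ := ih' hx hw.2
      have := join h hT' (Finset.disjoint_insert_right.2 ⟨hw.1, hd⟩)
      rw [Finset.union_insert, show i + (j + 1) + 1 = i + j + 1 + 1 by omega] at this
      exact ⟨_, this, by grind⟩

end IsRootedTree

/-- A set of vertices that is connected in `G` has a spanning tree. -/
theorem exists_isRootedTree [DecidableEq V] {G : SimpleGraph V} {H : Finset V} {v : V} (hv : v ∈ H)
    (hconn : ∀ w ∈ H, ∃ q : G.Walk v w, ∀ x ∈ q.support, x ∈ H) :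
    ∃ T, IsRootedTree (H.card - 1) v H T ∧ ∀ z ∈ T, z ∈ G.edgeSet := by
  -- Grow the tree inside `H`: a walk in `H` from the root to an unreached vertex leaves the current
  -- tree along an edge of `G`.
  have key : ∀ e, e + 1 ≤ H.card →
      ∃ K ⊆ H, ∃ T, IsRootedTree e v K T ∧ ∀ z ∈ T, z ∈ G.edgeSet := by
    intro e
    induction e with
    | zero => exact fun _ => ⟨{v}, by simpa using hv, ∅, .single v, by simp⟩
    | succ e ih =>
      intro he
      obtain ⟨K, hK, T, hT, hG⟩ := ih (by omega)
      have hcard := hT.card_verts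
      obtain ⟨w, hw, hwK⟩ := Finset.exists_mem_notMem_of_card_lt_card (s := K) (t := H) (by omega)
      obtain ⟨q, hq⟩ := hconn w hw
      obtain ⟨⟨⟨x, y⟩, hxy⟩, hd, hx, hy⟩ := q.exists_boundary_dart K hT.root_mem hwK
      obtain ⟨T', hT', hsub⟩ := hT.exists_insert (x := x) (w := y) hx hy
      refine ⟨insert y K, ?_, T', hT', ?_⟩
      · exact Finset.insert_subset (hq _ (q.dart_snd_mem_support_of_mem_darts hd)) hK
      · intro z hz
        rcases Finset.mem_insert.1 (hsub hz) with rfl | hz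
        · exact hxy
        · exact hG z hz
  have hpos : 0 < H.card := Finset.card_pos.2 ⟨v, hv⟩
  obtain ⟨K, hK, T, hT, hG⟩ := key (H.card - 1) (by omega)
  have hcard := hT.card_verts
  obtain rfl := Finset.eq_of_subset_of_card_le hK (by omega)
  exact ⟨T, hT, hG⟩

open Classical in
/-- The trees with `e` edges and root `v`. -/
noncomputable def rootedTrees [Fintype V] (e : ℕ) (v : V) : Finset (Finset V × Finset (Sym2 V)) :=
  Finset.univ.filter fun x => IsRootedTree e v x.1 x.2

/-- Undoing a `join` gives Catalan's recursion, the choice of `u` contributing one factor `|V|` per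
edge. A tree may split in several ways, which is harmless for an upper bound. -/
theorem card_rootedTrees_le [Fintype V] (e : ℕ) (v : V) :
    (rootedTrees e v).card ≤ Fintype.card V ^ e * catalan e := by
  classical
  induction e using Nat.strong_induction_on generalizing v with
  | _ e ih =>
  cases e with
  | zero =>
    rw [pow_zero, catalan_zero, one_mul, Finset.card_le_one_iff_subset_singleton]
    refine ⟨({v}, ∅), fun x hx => ?_⟩
    obtain ⟨H, T⟩ := x
    simp only [rootedTrees, Finset.mem_filter, Finset.mem_univ, true_and] at hx
    cases hx
    simp
  | succ e =>
    have hsub : rootedTrees (e + 1) v ⊆ (Finset.univ : Finset (Fin e.succ)).biUnion fun i =>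
        (Finset.univ : Finset V).biUnion fun u =>
          (rootedTrees (i : ℕ) v ×ˢ rootedTrees (e - i) u).image fun y =>
            (y.1.1 ∪ y.2.1, insert s(v, u) (y.1.2 ∪ y.2.2)) := by
      rintro ⟨H, T⟩ hx
      simp only [rootedTrees, Finset.mem_filter, Finset.mem_univ, true_and] at hx
      generalize he : e + 1 = e' at hx
      cases hx with
      | single => omega
      | @join i j _ u H K T U h h' hd =>
        obtain rfl : e = i + j := by omega
        rw [Finset.mem_biUnion]
        refine ⟨⟨i, by omega⟩, Finset.mem_univ _, ?_⟩
        rw [Finset.mem_biUnion]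
        refine ⟨u, Finset.mem_univ _, ?_⟩
        rw [Finset.mem_image]
        refine ⟨((H, T), (K, U)), ?_, rfl⟩
        simp only [rootedTrees, Finset.mem_product, Finset.mem_filter, Finset.mem_univ, true_and]
        exact ⟨by convert h, by convert h'; omega⟩
    refine (Finset.card_le_card hsub).trans (Finset.card_biUnion_le.trans ?_)
    rw [catalan_succ, Finset.mul_sum]
    refine Finset.sum_le_sum fun i _ => Finset.card_biUnion_le.trans ?_
    have hi : (i : ℕ) ≤ e := by omega
    refine (Finset.sum_le_card_nsmul _ _
      (Fintype.card V ^ e * (catalan i * catalan (e - i))) fun u _ => ?_).trans ?_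
    · refine Finset.card_image_le.trans ?_
      rw [Finset.card_product]
      refine (Nat.mul_le_mul (ih i (by omega) v) (ih (e - i) (by omega) u)).trans_eq ?_
      rw [mul_mul_mul_comm, ← pow_add, Nat.add_sub_cancel' hi]
    · rw [Finset.card_univ, smul_eq_mul, pow_succ]
      exact le_of_eq (by ring)

theorem catalan_le_four_pow (e : ℕ) : catalan e ≤ 4 ^ e := by
  rw [catalan_eq_centralBinom_div]
  exact (Nat.div_le_self _ _).trans (Nat.centralBinom_le_four_pow e)

end RandomGraphPaths

/-! ### Exponential moments in the binomial random graph -/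

namespace RandomGraphPaths

open SimpleGraph

variable {V : Type*} [Fintype V]

open Classical in
/-- The first moment bound for a product of edge weights in the binomial random graph, with a set
`T` of prescribed edges. -/
theorem mul_binomialRandom_real_le_prod (p : unitInterval) (A : Set (SimpleGraph V))
    (T : Finset (Sym2 V)) {c : ℝ} (x : Sym2 V → ℝ) (hx : ∀ z, 0 ≤ x z)
    (hA : ∀ G ∈ A, T ⊆ G.edgeFinset ∧ c ≤ ∏ z ∈ G.edgeFinset, x z) :
    c * (binomialRandom V p).real A ≤
      ∏ z ∈ (⊤ : SimpleGraph V).edgeFinset,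
        ((p : ℝ) * x z + if z ∈ T then 0 else 1 - (p : ℝ)) := by
  have hp0 : 0 ≤ (p : ℝ) := p.2.1
  have hp1 : 0 ≤ 1 - (p : ℝ) := sub_nonneg.2 p.2.2
  rcases le_or_gt c 0 with hc | hc
  · refine (mul_nonpos_of_nonpos_of_nonneg hc MeasureTheory.measureReal_nonneg).trans
      (Finset.prod_nonneg fun z _ => ?_)
    have := hx z
    split_ifs <;> positivity
  set D : Finset (Sym2 V) := (⊤ : SimpleGraph V).edgeFinset with hD
  have hsub : ∀ G : SimpleGraph V, G.edgeFinset ⊆ D := fun G => edgeFinset_mono le_top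
  have hcardD : D.card = (Nat.card V).choose 2 := by
    rw [hD, card_edgeFinset_top_eq_card_choose_two, Nat.card_eq_fintype_card]
  have hsingle : ∀ G : SimpleGraph V, (binomialRandom V p).real {G} =
      (∏ _z ∈ G.edgeFinset, (p : ℝ)) * ∏ _z ∈ D \ G.edgeFinset, (1 - (p : ℝ)) := by
    intro G
    rw [MeasureTheory.measureReal_def, binomialRandom_singleton, Finset.prod_const, Finset.prod_const,
      Finset.card_sdiff_of_subset (hsub G), hcardD, ← Set.ncard_coe_finset, coe_edgeFinset]
    simp
  have hunion : (binomialRandom V p).real A ≤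
      ∑ G ∈ Finset.univ.filter (· ∈ A), (binomialRandom V p).real {G} := by
    refine le_trans (le_of_eq ?_) (MeasureTheory.measureReal_biUnion_finset_le _ _)
    congr 1
    ext G
    simp
  calc c * (binomialRandom V p).real A
      ≤ ∑ G ∈ Finset.univ.filter (· ∈ A), c * (binomialRandom V p).real {G} := by
        rw [← Finset.mul_sum]
        exact mul_le_mul_of_nonneg_left hunion hc.le
    _ ≤ ∑ G ∈ Finset.univ.filter (· ∈ A), ((∏ z ∈ G.edgeFinset, (p : ℝ) * x z) *
          ∏ z ∈ D \ G.edgeFinset, if z ∈ T then 0 else 1 - (p : ℝ)) := by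
        refine Finset.sum_le_sum fun G hG => ?_
        obtain ⟨hT, hcG⟩ := hA G (Finset.mem_filter.1 hG).2
        have h : ∏ z ∈ D \ G.edgeFinset, (if z ∈ T then 0 else 1 - (p : ℝ)) =
            ∏ _z ∈ D \ G.edgeFinset, (1 - (p : ℝ)) := by
          refine Finset.prod_congr rfl fun z hz => if_neg fun hzT => ?_
          exact (Finset.mem_sdiff.1 hz).2 (hT hzT)
        rw [h, hsingle, Finset.prod_mul_distrib, mul_comm c, mul_right_comm]
        refine mul_le_mul_of_nonneg_right (mul_le_mul_of_nonneg_left hcG ?_) ?_ <;>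
        exact Finset.prod_nonneg fun _ _ => by assumption
    -- All terms are nonnegative, so the sum may run over all edge sets; it is then the expansion of
    -- a product. The zeros remove the sets that miss an edge of `T`.
    _ ≤ ∑ E ∈ D.powerset, ((∏ z ∈ E, (p : ℝ) * x z) *
          ∏ z ∈ D \ E, if z ∈ T then 0 else 1 - (p : ℝ)) := by
        rw [← Finset.sum_image (s := Finset.univ.filter (· ∈ A))
          (g := fun G : SimpleGraph V => G.edgeFinset)
          (f := fun E => (∏ z ∈ E, (p : ℝ) * x z) *
            ∏ z ∈ D \ E, if z ∈ T then 0 else 1 - (p : ℝ))]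
        · refine Finset.sum_le_sum_of_subset_of_nonneg ?_ fun E _ _ => ?_
          · intro E hE
            obtain ⟨G, -, rfl⟩ := Finset.mem_image.1 hE
            exact Finset.mem_powerset.2 (hsub G)
          · refine mul_nonneg (Finset.prod_nonneg fun z _ => mul_nonneg hp0 (hx z))
              (Finset.prod_nonneg fun z _ => ?_)
            split_ifs
            exacts [le_rfl, hp1]
        · intro G _ G' _ h
          exact edgeFinset_inj.1 h
    _ = _ := (Finset.prod_add _ _ _).symm

open Classical in
-- Degrees are dependent, but counting by edges turns their sum into a combination of independent
-- indicators.
theorem sum_degree_eq_sum_edges (G : SimpleGraph V) (S : Finset V) :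
    ∑ u ∈ S, G.degree u = ∑ z ∈ G.edgeFinset, (S.filter (· ∈ z)).card := by
  simp_rw [← card_incidenceFinset_eq_degree, incidenceFinset_eq_filter, Finset.card_filter]
  exact Finset.sum_comm

open Classical in
/-- Chernoff's bound for the sum of the degrees of the vertices in `S`, jointly with the presence
of the edges in `T`. -/
theorem binomialRandom_edges_degrees_le (p : unitInterval) (S : Finset V) (T : Finset (Sym2 V))
    (hT : T ⊆ (⊤ : SimpleGraph V).edgeFinset) (X : ℝ) {l : ℝ} (hl : 0 ≤ l) :
    (binomialRandom V p).real {G : SimpleGraph V | T ⊆ G.edgeFinset ∧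
        X ≤ ∑ u ∈ S, (G.degree u : ℝ)} ≤
      ((p : ℝ) * Real.exp (2 * l)) ^ T.card *
        Real.exp ((p : ℝ) * ((Real.exp (2 * l) - 1) / 2) * (S.card * Fintype.card V) - l * X) := by
  have hp0 : 0 ≤ (p : ℝ) := p.2.1
  set D : Finset (Sym2 V) := (⊤ : SimpleGraph V).edgeFinset with hD
  set k : Sym2 V → ℕ := fun z => (S.filter (· ∈ z)).card with hk
  have hk2 : ∀ z, k z ≤ 2 := by
    intro z
    refine le_trans (Finset.card_le_card (t := z.toFinset) fun u hu => ?_) ?_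
    · simpa using (Finset.mem_filter.1 hu).2
    · by_cases hz : z.IsDiag
      · rw [Sym2.card_toFinset_of_isDiag z hz]; norm_num
      · rw [Sym2.card_toFinset_of_not_isDiag z hz]
  -- The chord of the convex function `exp (l k)` over `[0, 2]`; linearity in `k` lets the edge
  -- contributions be summed.
  have hexp : ∀ z, Real.exp (l * k z) ≤ 1 + (Real.exp (2 * l) - 1) / 2 * k z := by
    intro z
    have h1 : 1 ≤ Real.exp l := Real.one_le_exp hl
    have h2 : Real.exp (2 * l) = Real.exp l * Real.exp l := by rw [two_mul, Real.exp_add]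
    have hkz := hk2 z
    rw [h2]
    interval_cases k z
    · simp
    · simp only [Nat.cast_one, mul_one]
      nlinarith
    · rw [Nat.cast_ofNat, mul_comm l, h2]
      linarith
  have hmain := mul_binomialRandom_real_le_prod p
    {G : SimpleGraph V | T ⊆ G.edgeFinset ∧ X ≤ ∑ u ∈ S, (G.degree u : ℝ)} T
    (c := Real.exp (l * X)) (fun z => Real.exp (l * k z)) (fun z => (Real.exp_pos _).le) (by
      rintro G ⟨hTG, hX⟩
      refine ⟨hTG, ?_⟩
      rw [← Real.exp_sum, ← Finset.mul_sum, Real.exp_le_exp]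
      refine mul_le_mul_of_nonneg_left (hX.trans (le_of_eq ?_)) hl
      exact_mod_cast sum_degree_eq_sum_edges G S)
  have hsumD : ∑ z ∈ D, k z ≤ S.card * Fintype.card V := by
    refine ((Finset.sum_congr ?_ fun z _ => rfl).trans
      (sum_degree_eq_sum_edges (⊤ : SimpleGraph V) S).symm).le.trans ?_
    · ext z
      simp [hD]
    refine Finset.sum_le_card_nsmul _ _ _ fun u _ => ?_
    rw [← card_neighborFinset_eq_degree]
    exact Finset.card_le_univ _
  have hprod : ∏ z ∈ D, ((p : ℝ) * Real.exp (l * k z) + if z ∈ T then 0 else 1 - (p : ℝ)) ≤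
      ((p : ℝ) * Real.exp (2 * l)) ^ T.card *
        Real.exp ((p : ℝ) * ((Real.exp (2 * l) - 1) / 2) * (S.card * Fintype.card V)) := by
    rw [← Finset.prod_sdiff hT, mul_comm]
    have hfac : 0 ≤ (p : ℝ) * ((Real.exp (2 * l) - 1) / 2) := by
      have : 1 ≤ Real.exp (2 * l) := Real.one_le_exp (by positivity)
      exact mul_nonneg hp0 (by linarith)
    -- An edge of `T` costs at most `p exp (2 l)`; any other factor `1 + p (exp (l k) - 1)` is
    -- bounded by an exponential.
    refine mul_le_mul ?_ ?_ ?_ (by positivity)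
    · rw [← Finset.prod_const]
      refine Finset.prod_le_prod (fun z hz => ?_) fun z hz => ?_
      · rw [if_pos hz, add_zero]; positivity
      · rw [if_pos hz, add_zero]
        refine mul_le_mul_of_nonneg_left (Real.exp_le_exp.2 ?_) hp0
        rw [mul_comm]
        exact mul_le_mul_of_nonneg_right (by exact_mod_cast hk2 z) hl
    · have h1 : ∀ z ∈ D \ T, ((p : ℝ) * Real.exp (l * k z) + if z ∈ T then 0 else 1 - (p : ℝ)) ≤
          Real.exp ((p : ℝ) * ((Real.exp (2 * l) - 1) / 2) * k z) := by
        intro z hz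
        rw [if_neg (Finset.mem_sdiff.1 hz).2]
        refine le_trans ?_ (Real.add_one_le_exp _)
        have := mul_le_mul_of_nonneg_left (hexp z) hp0
        linarith
      refine (Finset.prod_le_prod (fun z hz => ?_) h1).trans ?_
      · rw [if_neg (Finset.mem_sdiff.1 hz).2]
        have := sub_nonneg.2 p.2.2
        positivity
      · rw [← Real.exp_sum, ← Finset.mul_sum, Real.exp_le_exp]
        refine mul_le_mul_of_nonneg_left ?_ hfac
        have h2 : ∑ z ∈ D \ T, k z ≤ S.card * Fintype.card V :=
          (Finset.sum_le_sum_of_subset Finset.sdiff_subset).trans hsumD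
        exact_mod_cast h2
    · refine Finset.prod_nonneg fun z hz => ?_
      rw [if_neg (Finset.mem_sdiff.1 hz).2]
      have := sub_nonneg.2 p.2.2
      positivity
  have := hmain.trans hprod
  rw [Real.exp_sub, ← mul_div_assoc, le_div_iff₀ (Real.exp_pos _), mul_comm]
  exact this

end RandomGraphPaths

/-! ### Heavy trees from unbroken paths, and the union bound -/

namespace RandomGraphPaths

open SimpleGraph

variable {V : Type*} [Fintype V]

open Classical in
/-- The normalised degree of a vertex of large degree, and `0` for the other vertices. -/
noncomputable def heaviness (G : SimpleGraph V) (d α : ℝ) (u : V) : ℝ :=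
  if (G.degree u : ℝ) ≤ (1 + α) * d then 0 else (G.degree u : ℝ) / d

theorem heaviness_nonneg (G : SimpleGraph V) {d α : ℝ} (hd : 0 ≤ d) (u : V) :
    0 ≤ heaviness G d α u := by
  unfold heaviness
  split_ifs <;> positivity

theorem weight_pos (G : SimpleGraph V) {d α γ c : ℝ} (hd : 0 < d) (hα : 0 < α) (hγ : 0 < γ)
    (u : V) : 0 < weight G d α γ c u := by
  unfold weight
  split_ifs with h
  · positivity
  · have h1 : 0 < (1 + α) * d := by positivity
    have h2 := h1.trans (not_le.1 h)
    positivity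

/-- For a heavy vertex with `x = Δ(u) / d ≥ 1` the logarithm is `(c + 1) ln d + ln x`; use `ln x ≤ x
- 1 ≤ x ln d`. A bound linear in `x` is what Chernoff's inequality can handle. -/
theorem log_weight_le (G : SimpleGraph V) {d α γ c : ℝ} (hd : 0 < d) (hld : 1 ≤ Real.log d)
    (hα : 0 < α) (hγ : 0 < γ) (hc : 0 < c) (u : V) :
    Real.log (weight G d α γ c u) ≤ -Real.log (1 + γ) +
      ((c + 2) * Real.log d + Real.log (1 + γ)) * heaviness G d α u := by
  have ha : 0 < Real.log (1 + γ) := Real.log_pos (by linarith)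
  unfold weight heaviness
  split_ifs with h
  · rw [Real.log_inv]; linarith
  · have h1 : (1 + α) * d < _ := not_le.1 h
    set x : ℝ := _ / d with hx
    have hx1 : 1 ≤ x := by
      rw [hx, one_le_div hd]
      nlinarith [mul_pos hα hd]
    have hdeg : ∀ y : ℝ, x = y / d → y = d * x := by
      intro y hy
      rw [hy]; field_simp
    rw [hdeg _ rfl, Real.log_mul (by positivity) (by positivity), Real.log_rpow hd,
      Real.log_mul hd.ne' (by positivity)]
    have h2 := Real.log_le_sub_one_of_pos (lt_of_lt_of_le one_pos hx1)
    nlinarith [mul_nonneg hc.le (sub_nonneg.2 hx1),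
      mul_nonneg (mul_nonneg hc.le (sub_nonneg.2 hx1)) (zero_le_one.trans hld),
      mul_nonneg ha.le (sub_nonneg.2 hx1), mul_nonneg (sub_nonneg.2 hld) (sub_nonneg.2 hx1)]

open Classical in
/-- On a path of weight more than `1`, the mass of the heavy vertices is proportional to the number
of vertices. -/
theorem length_le_of_one_lt_walkWeight (G : SimpleGraph V) {d α γ c : ℝ} (hd : 0 < d)
    (hld : 1 ≤ Real.log d) (hα : 0 < α) (hγ : 0 < γ) (hc : 0 < c) {v w : V} (q : G.Walk v w)
    (hq : q.IsPath) (h : 1 < walkWeight G d α γ c q) :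
    (q.length : ℝ) + 1 ≤ ((c + 2) * Real.log d / Real.log (1 + γ) + 1) *
      ∑ u ∈ q.support.toFinset, heaviness G d α u := by
  have ha : 0 < Real.log (1 + γ) := Real.log_pos (by linarith)
  have hcard : (q.support.toFinset.card : ℝ) = q.length + 1 := by
    rw [List.toFinset_card_of_nodup hq.support_nodup, Walk.length_support]
    push_cast; rfl
  rw [walkWeight, ← List.prod_toFinset _ hq.support_nodup] at h
  have h1 := Real.log_pos h
  rw [Real.log_prod fun u _ => (weight_pos G hd hα hγ u).ne'] at h1
  have h2 := h1.trans_le (Finset.sum_le_sum fun u _ => log_weight_le G hd hld hα hγ hc u)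
  rw [Finset.sum_add_distrib, Finset.sum_const, nsmul_eq_mul, hcard, ← Finset.mul_sum] at h2
  refine le_of_mul_le_mul_left ?_ ha
  have h3 : Real.log (1 + γ) * ((c + 2) * Real.log d / Real.log (1 + γ) + 1) =
      (c + 2) * Real.log d + Real.log (1 + γ) := by field_simp
  rw [← mul_assoc, h3]
  linarith

open Classical in
/-- An unbroken path gives a subtree of the graph in which the sum of the large degrees is
proportional to the number of vertices. -/
theorem exists_heavy_tree {G : SimpleGraph V} {d α γ c : ℝ} (hd : 0 < d)
    (hld : 1 ≤ Real.log d) (hd5 : Real.log d ^ 5 ≤ d ^ (2 / 5 : ℝ))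
    (hα : 0 < α) (hγ : 0 < γ) (hc : 0 < c) (hr : 0 < radius V d)
    (h : HasUnbrokenPath G d α γ c) :
    ∃ (e : ℕ) (v : V), ∃ x ∈ rootedTrees e v, ∃ S ⊆ x.1, x.2 ⊆ G.edgeFinset ∧
      radius V d < (e : ℝ) + 1 ∧ (1 + α) * d * S.card ≤ ∑ u ∈ S, (G.degree u : ℝ) ∧
      ((e : ℝ) + 1) * d ≤ 7 * ((c + 2) * Real.log d / Real.log (1 + γ) + 1) *
        ∑ u ∈ S, (G.degree u : ℝ) := by
  obtain ⟨a, b, p, ⟨hp, hcyc⟩, hlen, hbreak⟩ := h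
  have ha : 0 < Real.log (1 + γ) := Real.log_pos (by linarith)
  set β : ℝ := (c + 2) * Real.log d / Real.log (1 + γ) + 1 with hβ
  have hβ0 : 0 ≤ β := by positivity
  have hlogn : 0 ≤ Real.log (Fintype.card V : ℝ) := by
    have := mul_pos hr (Real.rpow_pos_of_pos hd (2 / 5))
    rw [radius, div_mul_cancel₀ _ (by positivity)] at this
    exact this.le
  -- Only the first `m` edges are used. A walk of length at most `2 m` and a piece of this segment
  -- then close up to a cycle of length at most `3 m < 10 * radius V d`.
  set m : ℕ := ⌊radius V d⌋₊ with hm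
  have hmr : (m : ℝ) ≤ radius V d := Nat.floor_le hr.le
  have hml : m ≤ p.length := by
    rw [hlen]
    refine Nat.floor_le_floor ?_
    rw [radius]
    gcongr
  have hlen' : (p.take m).length = m := by rw [Walk.take_length, min_eq_left hml]
  have hsub : (p.take m).support ⊆ p.support := (p.isSubwalk_take m).support_subset
  have hgeo : ∀ i j : ℕ, i ≤ j → j ≤ (p.take m).length →
      ∀ q : G.Walk ((p.take m).getVert i) ((p.take m).getVert j),
        q.length ≤ 2 * m → j ≤ i + q.length := by
    intro i j hij hj q hq
    refine dist_le_of_no_short_cycle (p.take m) (hp.take m) (N := 3 * m) (M := 2 * m) ?_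
      (by omega) hij hj q hq
    intro u C hC hCl s t hs ht hsC htC
    by_contra hst
    refine hcyc ⟨u, C, hC, ?_, s, t, hst, hsub hs, hsub ht, hsC, htC⟩
    have : (C.length : ℝ) ≤ 3 * m := by exact_mod_cast hCl
    linarith
  obtain ⟨H, haH, hHcard, hconn, hHmass⟩ := exists_connected_of_geodesic (p.take m) (hp.take m)
    (R := m) hβ0 (heaviness G d α) (heaviness_nonneg G hd.le) hgeo (by
      intro v hv
      have hv' := hbreak v (hsub hv)
      rw [IsBreakPoint, not_le] at hv'
      obtain ⟨w, q, hq, hql, hqw⟩ := (isGreatest_influence G d α γ c hd.le v).1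
      rw [hqw] at hv'
      exact ⟨w, q, hq, Nat.le_floor hql,
        length_le_of_one_lt_walkWeight G hd hld hα hγ hc q hq hv'⟩)
  rw [hlen'] at hHcard
  obtain ⟨T, hT, hTG⟩ := exists_isRootedTree haH hconn
  have he : ((H.card - 1 : ℕ) : ℝ) + 1 = H.card := by
    rw [← Nat.cast_add_one, Nat.sub_add_cancel (by omega)]
  refine ⟨H.card - 1, a, (H, T), ?_, H.filter fun u => ¬ (G.degree u : ℝ) ≤ (1 + α) * d,
    Finset.filter_subset _ _, ?_, ?_, ?_, ?_⟩
  · simpa [rootedTrees] using hT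
  · intro z hz
    simpa using hTG z hz
  · rw [he]
    refine (Nat.lt_floor_add_one _).trans_le ?_
    exact_mod_cast hHcard
  · rw [mul_comm, ← nsmul_eq_mul]
    exact Finset.card_nsmul_le_sum _ _ _ fun u hu => (not_le.1 (Finset.mem_filter.1 hu).2).le
  · rw [he]
    have hsum : ∑ u ∈ H, heaviness G d α u =
        (∑ u ∈ H.filter (fun u => ¬ (G.degree u : ℝ) ≤ (1 + α) * d), (G.degree u : ℝ)) / d := by
      rw [Finset.sum_filter, Finset.sum_div]
      refine Finset.sum_congr rfl fun u _ => ?_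
      unfold heaviness
      split_ifs <;> simp_all
    rw [hsum, ← mul_div_assoc, le_div_iff₀ hd] at hHmass
    exact hHmass

open Classical in
/-- The probability that a given tree is contained in the random graph and that the sum of the
degrees of a given set of vertices is large. -/
theorem binomialRandom_heavy_tree_le (p : unitInterval) {d α Y : ℝ}
    (hpd : (p : ℝ) * Fintype.card V = d) (hα : 0 < α) (hα' : α < 3 / 2)
    (S : Finset V) (T : Finset (Sym2 V)) :
    (binomialRandom V p).real {G : SimpleGraph V | T ⊆ G.edgeFinset ∧
        (1 + α) * d * S.card ≤ ∑ u ∈ S, (G.degree u : ℝ) ∧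
        Y ≤ ∑ u ∈ S, (G.degree u : ℝ)} ≤
      ((p : ℝ) * Real.exp (α / 2)) ^ T.card * Real.exp (-(α ^ 2 / (8 * (1 + α)) * Y)) := by
  have hp0 : 0 ≤ (p : ℝ) := p.2.1
  by_cases hT : T ⊆ (⊤ : SimpleGraph V).edgeFinset
  · set X : ℝ := max ((1 + α) * d * S.card) Y with hX
    have hsub : {G : SimpleGraph V | T ⊆ G.edgeFinset ∧
        (1 + α) * d * S.card ≤ ∑ u ∈ S, (G.degree u : ℝ) ∧ Y ≤ ∑ u ∈ S, (G.degree u : ℝ)} ⊆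
        {G : SimpleGraph V | T ⊆ G.edgeFinset ∧ X ≤ ∑ u ∈ S, (G.degree u : ℝ)} :=
      fun G hG => ⟨hG.1, max_le hG.2.1 hG.2.2⟩
    refine (MeasureTheory.measureReal_mono hsub).trans ?_
    -- With `l = α / 4`, `exp (2 l) - 1 ≤ α/2 + (α/2)²` since `α / 2 ≤ 1`. As `d |S| ≤ X / (1 + α)`,
    -- the exponent is at most `-α² X / (8 (1 + α))`.
    refine (binomialRandom_edges_degrees_le p S T hT X (l := α / 4) (by positivity)).trans ?_
    rw [show 2 * (α / 4) = α / 2 by ring]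
    refine mul_le_mul_of_nonneg_left (Real.exp_le_exp.2 ?_) (by positivity)
    have h1 : Real.exp (α / 2) - 1 ≤ α / 2 + (α / 2) ^ 2 := by
      have := (abs_le.1 (Real.abs_exp_sub_one_sub_id_le
        (x := α / 2) (by rw [abs_of_pos (by positivity)]; linarith))).2
      linarith
    have h2 : (1 + α) * (d * S.card) ≤ X := by
      rw [← mul_assoc]; exact le_max_left _ _
    have h3 : Y ≤ X := le_max_right _ _
    have hds : 0 ≤ d * S.card := by rw [← hpd]; positivity
    have h4 : (p : ℝ) * ((Real.exp (α / 2) - 1) / 2) * (S.card * Fintype.card V) ≤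
        (d * S.card) * (α / 4 * (1 + α / 2)) := by
      calc (p : ℝ) * ((Real.exp (α / 2) - 1) / 2) * (S.card * Fintype.card V)
          = (d * S.card) * ((Real.exp (α / 2) - 1) / 2) := by rw [← hpd]; ring
        _ ≤ _ := mul_le_mul_of_nonneg_left (by linarith) hds
    have h5 : (d * S.card) * (α / 4 * (1 + α / 2)) ≤
        X / (1 + α) * (α / 4 * (1 + α / 2)) := by
      refine mul_le_mul_of_nonneg_right ?_ (by positivity)
      rw [le_div_iff₀ (by positivity)]
      linarith
    have h6 : X / (1 + α) * (α / 4 * (1 + α / 2)) - α / 4 * X = -(α ^ 2 / (8 * (1 + α)) * X) := by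
      field_simp
      ring
    have h7 : α ^ 2 / (8 * (1 + α)) * Y ≤ α ^ 2 / (8 * (1 + α)) * X :=
      mul_le_mul_of_nonneg_left h3 (by positivity)
    linarith
  -- Here `T` contains a loop, so the event is empty.
  · have : {G : SimpleGraph V | T ⊆ G.edgeFinset ∧
        (1 + α) * d * S.card ≤ ∑ u ∈ S, (G.degree u : ℝ) ∧
        Y ≤ ∑ u ∈ S, (G.degree u : ℝ)} = ∅ := by
      refine Set.eq_empty_of_forall_notMem fun G hG => hT (hG.1.trans ?_)
      exact edgeFinset_mono le_top
    rw [this, MeasureTheory.measureReal_empty]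
    positivity

/-- The union bound over all the heavy trees. -/
theorem binomialRandom_hasUnbrokenPath_le (p : unitInterval) {d α γ c : ℝ}
    (hpd : (p : ℝ) * Fintype.card V = d) (hd : 0 < d) (hld : 1 ≤ Real.log d)
    (hd5 : Real.log d ^ 5 ≤ d ^ (2 / 5 : ℝ)) (hα : 0 < α) (hα' : α < 3 / 2) (hγ : 0 < γ)
    (hc : 0 < c) (hr : 0 < radius V d) {D : ℝ} (hD0 : 0 ≤ D)
    (hD : D + Real.log 8 + Real.log d + α / 2 ≤ α ^ 2 / (8 * (1 + α)) *
      (d / (7 * ((c + 2) * Real.log d / Real.log (1 + γ) + 1)))) :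
    (binomialRandom V p).real {G : SimpleGraph V | HasUnbrokenPath G d α γ c} ≤
      (Fintype.card V : ℝ) ^ 2 * Real.exp (-(radius V d * D)) := by
  classical
  have ha : 0 < Real.log (1 + γ) := Real.log_pos (by linarith)
  set β : ℝ := (c + 2) * Real.log d / Real.log (1 + γ) + 1 with hβ
  have hβ0 : 0 < β := by positivity
  set n : ℕ := Fintype.card V with hn
  have hd1 : 1 ≤ d := by
    by_contra hlt
    have := Real.log_nonpos hd.le (not_le.1 hlt).le
    linarith
  set A : ℕ → Finset (Sym2 V) → Finset V → Set (SimpleGraph V) := fun e T S =>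
    {G : SimpleGraph V | T ⊆ G.edgeFinset ∧
      (1 + α) * d * S.card ≤ ∑ u ∈ S, (G.degree u : ℝ) ∧
      ((e : ℝ) + 1) * (d / (7 * β)) ≤ ∑ u ∈ S, (G.degree u : ℝ)} with hA
  set I : Finset ℕ := (Finset.range n).filter fun e => radius V d < (e : ℝ) + 1 with hI
  have hsub : {G : SimpleGraph V | HasUnbrokenPath G d α γ c} ⊆
      ⋃ e ∈ I, ⋃ v ∈ (Finset.univ : Finset V), ⋃ x ∈ rootedTrees e v,
        ⋃ S ∈ x.1.powerset, A e x.2 S := by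
    intro G hG
    obtain ⟨e, v, x, hx, S, hS, hT, her, hdeg, hmass⟩ :=
      exists_heavy_tree hd hld hd5 hα hγ hc hr hG
    have hcard : x.1.card = e + 1 := by
      have : IsRootedTree e v x.1 x.2 := by simpa [rootedTrees] using hx
      exact this.card_verts
    have hen : e < n := by
      have := Finset.card_le_univ x.1
      omega
    simp only [Set.mem_iUnion]
    refine ⟨e, Finset.mem_filter.2 ⟨Finset.mem_range.2 hen, her⟩, v, Finset.mem_univ _, x, hx, S,
      Finset.mem_powerset.2 hS, ?_, ?_, ?_⟩
    · intro z hz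
      simpa using hT hz
    · convert hdeg
    · rw [mul_div_assoc', div_le_iff₀ (by positivity), mul_comm (Finset.sum _ _)]
      convert hmass
  set Q : ℕ → ℝ := fun e => ((p : ℝ) * Real.exp (α / 2)) ^ e *
    Real.exp (-(α ^ 2 / (8 * (1 + α)) * (((e : ℝ) + 1) * (d / (7 * β))))) with hQ
  have hp0 : 0 ≤ (p : ℝ) := p.2.1
  have hQ0 : ∀ e, 0 ≤ Q e := fun e => by positivity
  have hstep : ∀ e : ℕ, (binomialRandom V p).real (⋃ v ∈ (Finset.univ : Finset V),
      ⋃ x ∈ rootedTrees e v, ⋃ S ∈ x.1.powerset, A e x.2 S) ≤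
      n * ((n ^ e * 4 ^ e) * (2 ^ (e + 1) * Q e)) := by
    intro e
    refine (MeasureTheory.measureReal_biUnion_finset_le _ _).trans ?_
    refine (Finset.sum_le_card_nsmul _ _ ((n ^ e * 4 ^ e) * (2 ^ (e + 1) * Q e)) fun v _ => ?_).trans
      (by rw [Finset.card_univ, nsmul_eq_mul])
    refine (MeasureTheory.measureReal_biUnion_finset_le _ _).trans ?_
    refine (Finset.sum_le_card_nsmul _ _ (2 ^ (e + 1) * Q e) fun x hx => ?_).trans ?_
    · have hx' : IsRootedTree e v x.1 x.2 := by simpa [rootedTrees] using hx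
      refine (MeasureTheory.measureReal_biUnion_finset_le _ _).trans ?_
      refine (Finset.sum_le_card_nsmul _ _ (Q e) fun S _ => ?_).trans ?_
      · have := binomialRandom_heavy_tree_le p (Y := ((e : ℝ) + 1) * (d / (7 * β)))
          hpd hα hα' S x.2
        rw [hx'.card_edges] at this
        convert this
      · rw [Finset.card_powerset, hx'.card_verts, nsmul_eq_mul]
        push_cast
        exact le_rfl
    · rw [nsmul_eq_mul]
      refine mul_le_mul_of_nonneg_right ?_ (mul_nonneg (by positivity) (hQ0 e))
      have h := (card_rootedTrees_le e v).trans
        (Nat.mul_le_mul_left _ (catalan_le_four_pow e))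
      exact_mod_cast h
  have hterm : ∀ e ∈ I, n * ((n ^ e * 4 ^ e) * (2 ^ (e + 1) * Q e)) ≤
      n * Real.exp (-(radius V d * D)) := by
    intro e he
    have her : radius V d < (e : ℝ) + 1 := (Finset.mem_filter.1 he).2
    refine mul_le_mul_of_nonneg_left ?_ (Nat.cast_nonneg _)
    set y : ℝ := d * Real.exp (α / 2) with hy
    have hy1 : 1 ≤ y := one_le_mul_of_one_le_of_one_le hd1 (Real.one_le_exp (by positivity))
    set E : ℝ := Real.exp (-(α ^ 2 / (8 * (1 + α)) * (((e : ℝ) + 1) * (d / (7 * β))))) with hE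
    have h1 : ((n : ℝ) ^ e * 4 ^ e) * (2 ^ (e + 1) * Q e) = 2 * (8 * y) ^ e * E := by
      have h0 : (8 * y) ^ e = (n : ℝ) ^ e * 4 ^ e * 2 ^ e * ((p : ℝ) * Real.exp (α / 2)) ^ e := by
        rw [hy, ← hpd, ← mul_pow, ← mul_pow, ← mul_pow]
        congr 1
        ring
      rw [h0, hE]
      ring
    -- The spare `2` from the `2^(e+1)` subsets is absorbed to match the `e + 1` in the Chernoff
    -- exponent.
    have h2 : 2 * (8 * y) ^ e ≤ (8 * y) ^ (e + 1) := by
      rw [pow_succ, mul_comm]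
      exact mul_le_mul_of_nonneg_left (by linarith) (by positivity)
    have h3 : (8 * y) ^ (e + 1) =
        Real.exp (((e : ℝ) + 1) * (Real.log 8 + Real.log d + α / 2)) := by
      have : Real.log (8 * y) = Real.log 8 + Real.log d + α / 2 := by
        rw [Real.log_mul (by norm_num) (by positivity), hy, Real.log_mul hd.ne' (by positivity),
          Real.log_exp, add_assoc]
      rw [← this, ← Nat.cast_add_one, mul_comm ((e + 1 : ℕ) : ℝ), Real.exp_mul, Real.exp_log (by positivity),
        Real.rpow_natCast]
    rw [h1]
    refine (mul_le_mul_of_nonneg_right h2 (Real.exp_pos _).le).trans ?_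
    rw [h3, ← Real.exp_add, Real.exp_le_exp]
    have h4 := mul_le_mul_of_nonneg_left hD (show (0 : ℝ) ≤ (e : ℝ) + 1 by positivity)
    have h5 := mul_le_mul_of_nonneg_right her.le hD0
    linarith
  refine (MeasureTheory.measureReal_mono hsub (MeasureTheory.measure_ne_top _ _)).trans ?_
  refine (MeasureTheory.measureReal_biUnion_finset_le _ _).trans ?_
  refine (Finset.sum_le_sum fun e he => (hstep e).trans (hterm e he)).trans ?_
  -- One factor `n` counts the roots, the other the possible sizes `e`.
  rw [Finset.sum_const, nsmul_eq_mul, pow_two, mul_assoc]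
  refine mul_le_mul_of_nonneg_right ?_ (by positivity)
  have : I.card ≤ n := (Finset.card_filter_le _ _).trans (Finset.card_range n).le
  exact_mod_cast this

/-! ### Asymptotics in `d` and conclusion -/

open Filter in
-- With `t = d^(1/20)` all powers are integral: `d^(2/5) = t^8`, `d = t^20`, and eventually `ln d ≤
-- t`. The left side is `O(t^9)`, the right at least of order `t^19`.
theorem eventually_large_degree_bounds {κ b C : ℝ} (hκ : 0 < κ) (hb : 0 < b) (hC : 0 ≤ C)
    (a : ℝ) (ha : 0 ≤ a) :
    ∀ᶠ d : ℝ in atTop, 0 < d ∧ 1 ≤ Real.log d ∧ Real.log d ^ 5 ≤ d ^ (2 / 5 : ℝ) ∧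
      d ^ (2 / 5 : ℝ) * (2 + C * Real.log d) + Real.log 8 + Real.log d + a ≤
        κ * (d / (7 * (b * Real.log d + 1))) := by
  have h1 : ∀ᶠ d : ℝ in atTop, Real.log d ≤ d ^ (1 / 20 : ℝ) := by
    have := (isLittleO_log_rpow_atTop (show (0 : ℝ) < 1 / 20 by norm_num)).bound one_pos
    filter_upwards [this, eventually_ge_atTop 1] with d hd hd1
    rw [one_mul, Real.norm_eq_abs, Real.norm_eq_abs, abs_of_nonneg (Real.log_nonneg hd1),
      abs_of_nonneg (by positivity)] at hd
    exact hd
  have h2 : ∀ᶠ d : ℝ in atTop,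
      7 * (b + 1) * (2 + C + Real.log 8 + 1 + a) / κ ≤ d ^ (1 / 20 : ℝ) :=
    (tendsto_rpow_atTop (show (0 : ℝ) < 1 / 20 by norm_num)).eventually_ge_atTop _
  filter_upwards [h1, h2, eventually_gt_atTop 0,
    Real.tendsto_log_atTop.eventually_ge_atTop 1] with d hlog hbig hd hl1
  refine ⟨hd, hl1, ?_, ?_⟩
  all_goals
    set t : ℝ := d ^ (1 / 20 : ℝ) with ht
    have ht1 : 1 ≤ t := hl1.trans hlog
    have ht8 : d ^ (2 / 5 : ℝ) = t ^ 8 := by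
      rw [ht, ← Real.rpow_natCast, ← Real.rpow_mul hd.le]; norm_num
    have ht20 : d = t ^ 20 := by
      rw [ht, ← Real.rpow_natCast, ← Real.rpow_mul hd.le]; norm_num
    rw [ht8]
  · calc Real.log d ^ 5 ≤ t ^ 5 := by gcongr
      _ ≤ t ^ 8 := pow_le_pow_right₀ ht1 (by norm_num)
  · set y : ℝ := Real.log d with hy
    have hl8 : 0 ≤ Real.log 8 := Real.log_nonneg (by norm_num)
    have e1 : t ^ 8 * (2 + C * y) + Real.log 8 + y + a ≤
        (2 + C + Real.log 8 + 1 + a) * t ^ 9 := by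
      have i1 : 1 ≤ t ^ 9 := one_le_pow₀ ht1
      have i2 : t ≤ t ^ 9 := le_self_pow₀ ht1 (by norm_num)
      have i3 : t ^ 8 * (2 + C * y) ≤ t ^ 8 * ((2 + C) * t) := by
        gcongr
        nlinarith [mul_le_mul_of_nonneg_left hlog hC]
      have i4 : t ^ 8 * ((2 + C) * t) = (2 + C) * t ^ 9 := by ring
      nlinarith [mul_le_mul_of_nonneg_left i1 hl8, mul_le_mul_of_nonneg_left i1 ha]
    refine e1.trans ?_
    rw [div_le_iff₀ hκ] at hbig
    rw [mul_div_assoc', le_div_iff₀ (by positivity)]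
    have e2 : b * y + 1 ≤ (b + 1) * t := by nlinarith [mul_le_mul_of_nonneg_left hlog hb.le]
    calc (2 + C + Real.log 8 + 1 + a) * t ^ 9 * (7 * (b * y + 1))
        ≤ (2 + C + Real.log 8 + 1 + a) * t ^ 9 * (7 * ((b + 1) * t)) := by gcongr
      _ = 7 * (b + 1) * (2 + C + Real.log 8 + 1 + a) * t ^ 10 := by ring
      _ ≤ t * κ * t ^ 10 := by gcongr
      _ = κ * t ^ 11 := by ring
      _ ≤ κ * d := by
        rw [ht20]
        exact mul_le_mul_of_nonneg_left (pow_le_pow_right₀ ht1 (by norm_num)) hκ.le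

end RandomGraphPaths

/-- For fixed `γ, c > 0` and `α ∈ (0, 3/2)`, every sufficiently large `d`, and every `n` that is
sufficiently large in terms of `d`, the binomial random graph `G(n, d/n)` contains an elementary
path of length `⌊ln n / (ln d) ^ 5⌋` without break-points with probability at most
`n ^ (-(1/3) (γ / (1 + γ)) ln d)`. -/
theorem theorem7 (γ c α : ℝ) (hγ : 0 < γ) (hc : 0 < c) (hα : 0 < α) (hα' : α < 3 / 2) :
    ∃ d₀ : ℝ, ∀ d : ℝ, d₀ ≤ d → ∃ n₀ : ℕ, ∀ n : ℕ, n₀ ≤ n →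
      ∀ p : unitInterval, (p : ℝ) = d / (n : ℝ) →
        (SimpleGraph.binomialRandom (Fin n) p).real
            {G : SimpleGraph (Fin n) | RandomGraphPaths.HasUnbrokenPath G d α γ c}
          ≤ (n : ℝ) ^ (-(1 / 3 : ℝ) * (γ / (1 + γ)) * Real.log d) := by
  classical
  have ha : 0 < Real.log (1 + γ) := Real.log_pos (by linarith)
  set C : ℝ := 1 / 3 * (γ / (1 + γ)) with hC
  have hC0 : 0 ≤ C := by positivity
  obtain ⟨d₀, hd₀⟩ := Filter.eventually_atTop.1
    (RandomGraphPaths.eventually_large_degree_bounds (κ := α ^ 2 / (8 * (1 + α)))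
      (b := (c + 2) / Real.log (1 + γ)) (by positivity) (by positivity) hC0 (α / 2)
      (by positivity))
  -- `n₀ = 2` only ensures `ln n > 0`; that `p` is a probability already forces `d ≤ n`.
  refine ⟨d₀, fun d hdd => ⟨2, fun n hn p hp => ?_⟩⟩
  obtain ⟨hd, hld, hd5, hD⟩ := hd₀ d hdd
  have hn0 : (0 : ℝ) < n := by exact_mod_cast (by omega : 0 < n)
  have hlogn : 0 < Real.log n := Real.log_pos (by exact_mod_cast (by omega : 1 < n))
  have hpow : 0 < d ^ (2 / 5 : ℝ) := by positivity
  have hr : RandomGraphPaths.radius (Fin n) d = Real.log n / d ^ (2 / 5 : ℝ) := by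
    rw [RandomGraphPaths.radius, Fintype.card_fin]
  refine (RandomGraphPaths.binomialRandom_hasUnbrokenPath_le p (γ := γ) (c := c)
    -- Then `radius * D = (2 + C ln d) ln n`: the `2` cancels the prefactor `n²`, and `C ln d` is
    -- the exponent sought.
    (D := d ^ (2 / 5 : ℝ) * (2 + C * Real.log d)) ?_ hd hld hd5 hα hα' hγ hc ?_ ?_ ?_).trans
    (le_of_eq ?_)
  · rw [Fintype.card_fin, hp, div_mul_cancel₀ _ hn0.ne']
  · rw [hr]; positivity
  · positivity
  · rw [div_mul_eq_mul_div (c + 2)] at hD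
    exact hD
  · rw [hr, Fintype.card_fin, ← mul_assoc, div_mul_cancel₀ _ hpow.ne', Real.rpow_def_of_pos hn0,
      ← Real.exp_log (pow_pos hn0 2), Real.log_pow, ← Real.exp_add]
    congr 1
    rw [hC]
    push_cast
    ring
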